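/- **Theorem 3 (1D advection–diffusion).** For a set $M$ in a real vector space $X$ with lengths measured by $\|\cdot\|:X\to[0,\infty]$, let $$d_n(M)=\inf_{V\subset X,\ \dim V=n}\ \sup_{u\in M}\ \inf_{v\in V}\|u-v\|\in[0,\infty]$$ be its Kolmogorov $n$-width, the infimum being over all $n$-dimensional linear subspaces $V$. For $\mu>0$, $\sigma_0>0$ let $G(x,t)=\frac1{\sqrt{4\pi\mu t}}e^{-x^2/(4\mu t)}$, let $\phi$ be the indicator function of $(0.35,0.65)$, let $F(x)=\frac1{\sqrt{2\pi}}\int_{-\infty}^x e^{-s^2/2}\,ds$, and let $$u(x,t)=\big(G(\cdot,t+\sigma_0)*\phi\big)(x-t),\qquad x\in\mathbb R,\ t\ge 0.$$ Then $u$ is a classical solution of $u_t+u_x=\mu u_{xx}$ for $x\in\mathbb R$, $t\ge0$, with $u(\cdot,0)=G(\cdot,\sigma_0)*\phi$, and $$u(x,t)=F\Big(\tfrac{x-t-0.35}{\sqrt{2\mu(t+\sigma_0)}}\Big)-F\Big(\tfrac{x-t-0.65}{\sqrt{2\mu(t+\sigma_0)}}\Big).$$ *Eulerian frame.* For $T>0$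 let $\mathcal M_E=\{u(\cdot,t):t\in[0,T]\}\subset L^2(\mathbb R)$. Put $c=\frac{4-2\sqrt2}{\sqrt\pi}$. For every $T>0$ there is a constant $c_2>0$, depending only on $T$, such that for all $\mu>0$, all $\sigma_0>0$ and all integers $n\ge1$, $$d_n(\mathcal M_E)\ \ge\ c_2\,n^{-1/2}-\sqrt c\,\big(\mu(T+\sigma_0)\big)^{1/4}.$$ *Lagrangian frame.* Let $\chi(\hat x,t)=\hat x+t$ be the characteristic lines, and let $\mathcal M_L$ be the set of the functions $\hat x\mapsto\big(\chi(\hat x,t),\,u(\chi(\hat x,t),t)\big)$, $t\in[0,T]$, in the space of measurable functions $\mathbb R\to\mathbb R^2$ modulo equality almost everywhere, where lengths are measured by $\|(v_1,v_2)\|=\big(\int_{\mathbb R}(v_1^2+v_2^2)\,d\hat x\big)^{1/2}\in[0,\infty]$. For all $T,\mu,\sigma_0>0$ and all integers $n>2$, $$d_n(\mathcal M_L)\ \le\ C\,\frac{q^{\,n-2}}{1-q},\qquad q=\frac{T/2}{T/2+\sigma_0},\qquad C=\|\phi\|_{L^2(\mathbb R)}.$$ -/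

import Mathlib

open MeasureTheory Set
open scoped ENNReal

noncomputable section

namespace AdvectionDiffusion

/-- The Kolmogorov `n`-width of a set `M` in a real vector space `X`, where lengths are measured by
`N : X → [0, ∞]`: the infimum over all `n`-dimensional linear subspaces `V` of
`sup_{u ∈ M} inf_{v ∈ V} N (u - v)`. -/
def kolmogorovWidth {X : Type*} [AddCommGroup X] [Module ℝ X] (N : X → ℝ≥0∞) (M : Set X) (n : ℕ) :
    ℝ≥0∞ :=
  ⨅ (V : Submodule ℝ X) (_ : FiniteDimensional ℝ V ∧ Module.finrank ℝ V = n),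
    ⨆ u ∈ M, ⨅ v ∈ V, N (u - v)

/-- The heat kernel `G(x, t)` of `w_t = μ w_xx`. -/
def heatKernel (μ x t : ℝ) : ℝ :=
  1 / Real.sqrt (4 * Real.pi * μ * t) * Real.exp (-x ^ 2 / (4 * μ * t))

/-- The window function `φ`. -/
def window (x : ℝ) : ℝ := (Ioo (0.35 : ℝ) 0.65).indicator (fun _ => 1) x

/-- `(G(·, s) ∗ φ)(x)`. -/
def smoothedWindow (μ s x : ℝ) : ℝ := ∫ y, heatKernel μ (x - y) s * window y

/-- `u(x, t) = w(x - t, t)` with `w(·, t) = G(·, t + σ₀) ∗ φ`. -/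
def sol (μ σ₀ x t : ℝ) : ℝ := smoothedWindow μ (t + σ₀) (x - t)

/-- The standard normal cumulative distribution function. -/
def gaussCDF (x : ℝ) : ℝ :=
  1 / Real.sqrt (2 * Real.pi) * ∫ s in Iic x, Real.exp (-s ^ 2 / 2)

/-- `u` is a classical solution on `ℝ × [0, ∞)` of `u_t + u_x = μ u_xx`, `u(·, 0) = u₀`. -/
structure IsSolution (μ : ℝ) (u₀ : ℝ → ℝ) (u : ℝ → ℝ → ℝ) : Prop where
  contDiff_space : ∀ t, 0 ≤ t → ContDiff ℝ 2 (fun x => u x t)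
  equation : ∀ t, 0 ≤ t → ∀ x, HasDerivWithinAt (fun s => u x s)
    (μ * iteratedDeriv 2 (fun y => u y t) x - deriv (fun y => u y t) x) (Ici 0) t
  initial : ∀ x, u x 0 = u₀ x

/-- The characteristic line `χ(x̂, t)`: `dχ/dt = 1`, `χ(x̂, 0) = x̂`. -/
def charLine (x t : ℝ) : ℝ := x + t

/-- The Lagrangian state `x̂ ↦ (χ(x̂, t), u(χ(x̂, t), t))`. -/
def lagrangianState (μ σ₀ t : ℝ) (x : ℝ) : EuclideanSpace ℝ (Fin 2) :=
  !₂[charLine x t, sol μ σ₀ (charLine x t) t]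

lemma integrable_window : Integrable window := by
  unfold window
  exact (integrable_indicator_iff measurableSet_Ioo).2 (by simp)

lemma integrable_heatKernel (μ s : ℝ) : Integrable (fun x => heatKernel μ x s) := by
  unfold heatKernel
  rcases le_or_gt (μ * s) 0 with h | h
  · have : Real.sqrt (4 * Real.pi * μ * s) = 0 :=
      Real.sqrt_eq_zero_of_nonpos (by nlinarith [Real.pi_pos])
    simp [this]
  · have h4 : (0 : ℝ) < 1 / (4 * μ * s) := by
      have : 0 < 4 * μ * s := by nlinarith
      positivity
    refine ((integrable_exp_neg_mul_sq h4).const_mul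
      (1 / Real.sqrt (4 * Real.pi * μ * s))).congr (Filter.Eventually.of_forall ?_)
    intro x
    simp only
    congr 2
    ring

lemma memLp_smoothedWindow (μ s : ℝ) : MemLp (smoothedWindow μ s) 2 := by
  have hk := integrable_heatKernel μ s
  have hnn : ∀ x, 0 ≤ heatKernel μ x s := fun x => by unfold heatKernel; positivity
  have hint : Integrable (smoothedWindow μ s) := by
    have := integrable_window.integrable_convolution (ContinuousLinearMap.mul ℝ ℝ) hk
    refine this.congr (Filter.Eventually.of_forall fun x => ?_)
    simp [convolution, smoothedWindow, mul_comm]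
  have hw : ∀ y, 0 ≤ window y ∧ window y ≤ 1 := fun y => by
    unfold window
    by_cases h : y ∈ Ioo (0.35 : ℝ) 0.65
    · rw [indicator_of_mem h]; norm_num
    · rw [indicator_of_notMem h]; norm_num
  have hbd : ∀ x, ‖smoothedWindow μ s x‖ ≤ ∫ y, heatKernel μ y s := fun x => by
    have h1 : Integrable (fun y => heatKernel μ (x - y) s) := hk.comp_sub_left x
    calc ‖smoothedWindow μ s x‖ ≤ ∫ y, heatKernel μ (x - y) s := by
          refine norm_integral_le_of_norm_le h1 (Filter.Eventually.of_forall fun y => ?_)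
          rw [norm_mul, Real.norm_of_nonneg (hnn _), Real.norm_of_nonneg (hw y).1]
          exact mul_le_of_le_one_right (hnn _) (hw y).2
      _ = ∫ y, heatKernel μ y s := integral_sub_left_eq_self (fun y => heatKernel μ y s) volume x
  rw [memLp_two_iff_integrable_sq hint.aestronglyMeasurable]
  simp only [pow_two]
  exact hint.bdd_mul hint.aestronglyMeasurable (Filter.Eventually.of_forall hbd)

lemma memLp_sol (μ σ₀ t : ℝ) : MemLp (fun x => sol μ σ₀ x t) 2 :=
  (memLp_smoothedWindow μ (t + σ₀)).comp_measurePreserving (measurePreserving_sub_right volume t)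

lemma aestronglyMeasurable_lagrangianState (μ σ₀ t : ℝ) :
    AEStronglyMeasurable (lagrangianState μ σ₀ t) volume := by
  have h1 : AEMeasurable (smoothedWindow μ (t + σ₀)) volume :=
    (memLp_smoothedWindow μ (t + σ₀)).1.aemeasurable
  have h2 : AEMeasurable (fun x : ℝ => ![charLine x t, sol μ σ₀ (charLine x t) t]) volume := by
    refine aemeasurable_pi_iff.2 fun i => ?_
    fin_cases i
    · exact (measurable_id.add_const t).aemeasurable
    · simpa [sol, charLine] using h1
  exact ((PiLp.continuous_toLp 2 (fun _ : Fin 2 => ℝ)).measurable.comp_aemeasurable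
    h2).aestronglyMeasurable

/-- The Eulerian solution manifold `{u(·, t) : t ∈ [0, T]} ⊆ L²(ℝ)`. -/
def eulerianManifold (μ σ₀ T : ℝ) : Set (Lp ℝ 2 (volume : Measure ℝ)) :=
  (fun t => (memLp_sol μ σ₀ t).toLp) '' Icc 0 T

/-- The Lagrangian solution manifold `{(χ(·, t), u(χ(·, t), t)) : t ∈ [0, T]}`, in the space of
measurable functions `ℝ → ℝ²` modulo equality almost everywhere (`χ(·, t)` is not in `L²(ℝ)`). -/
def lagrangianManifold (μ σ₀ T : ℝ) : Set (ℝ →ₘ[volume] EuclideanSpace ℝ (Fin 2)) :=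
  (fun t => AEEqFun.mk (lagrangianState μ σ₀ t) (aestronglyMeasurable_lagrangianState μ σ₀ t)) ''
    Icc 0 T

/-- `d_n(M_E)`, with respect to the norm of `L²(ℝ)`. -/
def eulerianWidth (μ σ₀ T : ℝ) (n : ℕ) : ℝ≥0∞ :=
  kolmogorovWidth (fun f => ‖f‖ₑ) (eulerianManifold μ σ₀ T) n

/-- `d_n(M_L)`, with respect to `‖(v₁, v₂)‖ = (∫ v₁² + v₂²)^{1/2} ∈ [0, ∞]`. -/
def lagrangianWidth (μ σ₀ T : ℝ) (n : ℕ) : ℝ≥0∞ :=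
  kolmogorovWidth (fun f : ℝ →ₘ[volume] EuclideanSpace ℝ (Fin 2) => eLpNorm f 2 volume)
    (lagrangianManifold μ σ₀ T) n

end AdvectionDiffusion

end

open MeasureTheory Set
open scoped ENNReal FourierTransform
namespace AdvectionDiffusion

/-! Integrating the Gaussian over the window gives the closed form, and the chain rule gives the
equation.

Eulerian bound: differences of consecutive translates of `window` by a step `h` are `2n` orthogonal
vectors of squared length `2h`, and by Bessel an `n`-dimensional space captures at most half of
their total squared length (`Submodule.exists_le_norm_sub_sq_of_orthogonal`). So the translates
alone have width at least of order `n^(-1/2)`, and smoothing moves each by at most `√6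
(μ(T+σ₀))^(1/4)` in `L²` (`eLpNorm_smoothedWindow_sub_window_le`).

Lagrangian bound: along characteristics the transport disappears. The first component is `x + t ·
1`, which costs two dimensions; the second is the pure heat flow, with Fourier transform `exp(-L s)`
times that of `window`, `L ≥ 0`. Expanding in `s` about the midpoint `T/2 + σ₀` converges
geometrically with ratio `q`, uniformly in `L` (`Real.abs_exp_neg_mul_sub_sum_le`), and Plancherel
carries the error back to `L²`. -/

/-! ### The closed form through the normal CDF, and the differential equation. -/

lemma integrable_exp_neg_sq_div_two : Integrable fun s : ℝ => Real.exp (-s ^ 2 / 2) := by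
  refine (integrable_exp_neg_mul_sq (b := 1 / 2) (by norm_num)).congr
    (Filter.Eventually.of_forall fun x => ?_)
  simp only
  congr 1
  ring

lemma gaussCDF_sub_gaussCDF (a b : ℝ) :
    gaussCDF b - gaussCDF a =
      1 / Real.sqrt (2 * Real.pi) * ∫ s in a..b, Real.exp (-s ^ 2 / 2) := by
  unfold gaussCDF
  rw [← mul_sub, intervalIntegral.integral_Iic_sub_Iic
    integrable_exp_neg_sq_div_two.integrableOn integrable_exp_neg_sq_div_two.integrableOn]

lemma hasDerivAt_gaussCDF (x : ℝ) :
    HasDerivAt gaussCDF (1 / Real.sqrt (2 * Real.pi) * Real.exp (-x ^ 2 / 2)) x := by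
  have hc : Continuous fun s : ℝ => Real.exp (-s ^ 2 / 2) := by fun_prop
  have h := ((hc.integral_hasStrictDerivAt 0 x).hasDerivAt.const_mul
    (1 / Real.sqrt (2 * Real.pi))).const_add (gaussCDF 0)
  refine h.congr_of_eventuallyEq (Filter.Eventually.of_forall fun y => ?_)
  simp only
  rw [← gaussCDF_sub_gaussCDF]
  ring

lemma contDiff_gaussCDF : ContDiff ℝ 2 gaussCDF := by
  have : (2 : WithTop ℕ∞) = 1 + 1 := by norm_num
  rw [this, contDiff_succ_iff_deriv]
  refine ⟨fun x => (hasDerivAt_gaussCDF x).differentiableAt, by simp, ?_⟩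
  rw [show deriv gaussCDF = fun x => 1 / Real.sqrt (2 * Real.pi) * Real.exp (-x ^ 2 / 2) from
    funext fun x => (hasDerivAt_gaussCDF x).deriv]
  fun_prop

lemma heatKernel_eq {μ s : ℝ} (h : 0 < μ * s) (x : ℝ) :
    heatKernel μ x s = (Real.sqrt (2 * μ * s))⁻¹ *
      (1 / Real.sqrt (2 * Real.pi) * Real.exp (-(x / Real.sqrt (2 * μ * s)) ^ 2 / 2)) := by
  unfold heatKernel
  have h2 : 0 ≤ 2 * μ * s := by nlinarith
  rw [show 4 * Real.pi * μ * s = (2 * μ * s) * (2 * Real.pi) by ring, Real.sqrt_mul h2, div_pow,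
    Real.sq_sqrt h2, one_div, mul_inv, mul_assoc, one_div]
  congr 3
  have : μ * s ≠ 0 := h.ne'
  have h3 : μ ≠ 0 := left_ne_zero_of_mul this
  have h4 : s ≠ 0 := right_ne_zero_of_mul this
  field_simp
  norm_num

lemma smoothedWindow_eq_gaussCDF {μ s : ℝ} (h : 0 < μ * s) (z : ℝ) :
    smoothedWindow μ s z = gaussCDF ((z - 0.35) / Real.sqrt (2 * μ * s)) -
      gaussCDF ((z - 0.65) / Real.sqrt (2 * μ * s)) := by
  have hσ : Real.sqrt (2 * μ * s) ≠ 0 := (Real.sqrt_pos.2 (by nlinarith)).ne'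
  rw [gaussCDF_sub_gaussCDF]
  unfold smoothedWindow window
  have h1 : ∀ y, heatKernel μ (z - y) s * (Ioo (0.35 : ℝ) 0.65).indicator (fun _ => 1) y =
      (Ioo (0.35 : ℝ) 0.65).indicator (fun y => heatKernel μ (z - y) s) y := fun y => by
    by_cases hy : y ∈ Ioo (0.35 : ℝ) 0.65 <;> simp [hy]
  simp_rw [h1]
  rw [integral_indicator measurableSet_Ioo, ← integral_Ioc_eq_integral_Ioo,
    ← intervalIntegral.integral_of_le (by norm_num)]
  simp_rw [heatKernel_eq h, sub_div]
  rw [intervalIntegral.integral_const_mul, intervalIntegral.integral_const_mul,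
    intervalIntegral.integral_comp_sub_div (fun v => Real.exp (-v ^ 2 / 2)) hσ, smul_eq_mul]
  field_simp

lemma sol_eq_gaussCDF {μ σ₀ t : ℝ} (hμ : 0 < μ) (ht : 0 < t + σ₀) (x : ℝ) :
    sol μ σ₀ x t = gaussCDF ((x - t - 0.35) / Real.sqrt (2 * μ * (t + σ₀))) -
      gaussCDF ((x - t - 0.65) / Real.sqrt (2 * μ * (t + σ₀))) :=
  smoothedWindow_eq_gaussCDF (mul_pos hμ ht) _

lemma hasDerivAt_gaussCDF_space (σ t a x : ℝ) :
    HasDerivAt (fun y => gaussCDF ((y - t - a) / σ))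
      (1 / Real.sqrt (2 * Real.pi) * Real.exp (-((x - t - a) / σ) ^ 2 / 2) * (1 / σ)) x :=
  (hasDerivAt_gaussCDF _).comp x ((((hasDerivAt_id x).sub_const t).sub_const a).div_const σ)

lemma hasDerivAt_gaussCDF_space_deriv (σ t a x : ℝ) :
    HasDerivAt (fun y => 1 / Real.sqrt (2 * Real.pi) * Real.exp (-((y - t - a) / σ) ^ 2 / 2) *
        (1 / σ))
      (1 / Real.sqrt (2 * Real.pi) * (Real.exp (-((x - t - a) / σ) ^ 2 / 2) *
        (-((x - t - a) / σ) * (1 / σ))) * (1 / σ)) x := by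
  have h := (((hasDerivAt_id x).sub_const t).sub_const a).div_const σ
  have h2 := ((((h.pow 2).neg.div_const 2).exp).const_mul (1 / Real.sqrt (2 * Real.pi))).mul_const
    (1 / σ)
  refine h2.congr_deriv ?_
  simp
  ring

/-- With `σ = √(2μ(t+σ₀))` one has `σ' = μ/σ`. The first summand comes from transport and cancels
against `u_x`; the second comes from the spreading of `σ` and equals `μ u_xx`, because `F''(z) = -z
F'(z)`. -/
lemma hasDerivAt_gaussCDF_time {μ σ₀ t : ℝ} (hμ : 0 < μ) (ht : 0 < t + σ₀) (a x : ℝ) :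
    HasDerivAt (fun r => gaussCDF ((x - r - a) / Real.sqrt (2 * μ * (r + σ₀))))
      (1 / Real.sqrt (2 * Real.pi) *
        Real.exp (-((x - t - a) / Real.sqrt (2 * μ * (t + σ₀))) ^ 2 / 2) *
        (-(1 / Real.sqrt (2 * μ * (t + σ₀))) -
          μ * (x - t - a) / Real.sqrt (2 * μ * (t + σ₀)) ^ 3)) t := by
  have hpos : 0 < 2 * μ * (t + σ₀) := by positivity
  have hσ : Real.sqrt (2 * μ * (t + σ₀)) ≠ 0 := (Real.sqrt_pos.2 hpos).ne'
  have h1 : HasDerivAt (fun r => x - r - a) (-1) t :=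
    ((hasDerivAt_id t).const_sub x).sub_const a
  have h2 := (((hasDerivAt_id t).add_const σ₀).const_mul (2 * μ)).sqrt hpos.ne'
  refine ((hasDerivAt_gaussCDF _).comp t (h1.div h2 hσ)).congr_deriv ?_
  simp only [id]
  congr 1
  field_simp

theorem isSolution_sol {μ σ₀ : ℝ} (hμ : 0 < μ) (hσ₀ : 0 < σ₀) :
    IsSolution μ (smoothedWindow μ σ₀) (sol μ σ₀) := by
  have hcl : ∀ t, 0 ≤ t → (fun x => sol μ σ₀ x t) = fun x =>
      gaussCDF ((x - t - 0.35) / Real.sqrt (2 * μ * (t + σ₀))) -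
      gaussCDF ((x - t - 0.65) / Real.sqrt (2 * μ * (t + σ₀))) := fun t ht =>
    funext fun x => sol_eq_gaussCDF hμ (by linarith) x
  refine ⟨fun t ht => ?_, fun t ht x => ?_, fun x => by simp [sol]⟩
  · rw [hcl t ht]
    exact (contDiff_gaussCDF.comp (by fun_prop)).sub (contDiff_gaussCDF.comp (by fun_prop))
  · have ht' : 0 < t + σ₀ := by linarith
    have hσ : Real.sqrt (2 * μ * (t + σ₀)) ≠ 0 := (Real.sqrt_pos.2 (by positivity)).ne'
    have hx : deriv (fun y => sol μ σ₀ y t) = (fun y => 1 / Real.sqrt (2 * Real.pi) *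
        Real.exp (-((y - t - 0.35) / Real.sqrt (2 * μ * (t + σ₀))) ^ 2 / 2) *
        (1 / Real.sqrt (2 * μ * (t + σ₀)))) - fun y => 1 / Real.sqrt (2 * Real.pi) *
        Real.exp (-((y - t - 0.65) / Real.sqrt (2 * μ * (t + σ₀))) ^ 2 / 2) *
        (1 / Real.sqrt (2 * μ * (t + σ₀))) := by
      rw [hcl t ht]
      exact funext fun y => ((hasDerivAt_gaussCDF_space _ _ _ y).sub
        (hasDerivAt_gaussCDF_space _ _ _ y)).deriv
    have hxx := (hasDerivAt_gaussCDF_space_deriv (Real.sqrt (2 * μ * (t + σ₀))) t 0.35 x).sub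
      (hasDerivAt_gaussCDF_space_deriv (Real.sqrt (2 * μ * (t + σ₀))) t 0.65 x)
    have htime := (hasDerivAt_gaussCDF_time hμ ht' 0.35 x).sub
      (hasDerivAt_gaussCDF_time hμ ht' 0.65 x)
    refine (htime.hasDerivWithinAt.congr_of_mem (f₁ := fun s => sol μ σ₀ x s) (s := Ici 0)
      (fun r hr => congrFun (hcl r hr) x) ht).congr_deriv ?_
    rw [iteratedDeriv_succ, iteratedDeriv_one, hx]
    rw [hxx.deriv, Pi.sub_apply]
    field_simp
    ring

end AdvectionDiffusion

/-! ### Distance to a subspace, and orthogonal differences of translated windows. -/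

/-- A subspace of dimension `n` stays away from one of any `2 n` orthogonal vectors of equal
length. -/
theorem Submodule.exists_le_norm_sub_sq_of_orthogonal {H : Type*} [NormedAddCommGroup H]
    [InnerProductSpace ℝ H] (V : Submodule ℝ H) [FiniteDimensional ℝ V] {n : ℕ}
    (hV : Module.finrank ℝ V = n) (hn : 1 ≤ n) (ψ : Fin (2 * n) → H) {h : ℝ} (h0 : 0 < h)
    (horth : ∀ i j, inner ℝ (ψ i) (ψ j) = if i = j then 2 * h else 0) :
    ∃ i, ∀ v ∈ V, h ≤ ‖ψ i - v‖ ^ 2 := by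
  by_contra! hcon
  choose v hvV hv using hcon
  let b := stdOrthonormalBasis ℝ V
  have hnorm : ∀ i, ‖ψ i‖ ^ 2 = 2 * h := fun i => by
    rw [← real_inner_self_eq_norm_sq, horth, if_pos rfl]
  -- In coordinates, `‖v‖² - 2⟨ψ, v⟩` is bounded below by completing the square in each basis
  -- direction.
  have hdist : ∀ i, 2 * h - ∑ j, (inner ℝ (ψ i) (b j : H)) ^ 2 ≤ ‖ψ i - v i‖ ^ 2 := fun i => by
    have hn2 : ‖v i‖ ^ 2 = ∑ j, (inner ℝ (b j : H) (v i)) ^ 2 := by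
      have := b.sum_sq_norm_inner_right (⟨v i, hvV i⟩ : V)
      simpa [Submodule.coe_inner] using this.symm
    have hin : inner ℝ (ψ i) (v i) =
        ∑ j, inner ℝ (b j : H) (v i) * inner ℝ (ψ i) (b j : H) := by
      have h1 : v i = ∑ j, (inner ℝ (b j : H) (v i)) • (b j : H) := by
        have := congrArg (Subtype.val) (b.sum_repr' (⟨v i, hvV i⟩ : V))
        simpa [Submodule.coe_inner] using this.symm
      conv_lhs => rw [h1, inner_sum]
      exact Finset.sum_congr rfl fun j _ => real_inner_smul_right _ _ _
    rw [norm_sub_sq_real, hnorm, hn2, hin, sub_add, sub_le_sub_iff_left, Finset.mul_sum,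
      ← Finset.sum_sub_distrib]
    refine Finset.sum_le_sum fun j _ => ?_
    nlinarith [sq_nonneg (inner ℝ (ψ i) (b j : H) - inner ℝ (b j : H) (v i))]
  have hr : 0 < Real.sqrt (2 * h) := Real.sqrt_pos.2 (by linarith)
  have hon : Orthonormal ℝ fun i => (Real.sqrt (2 * h))⁻¹ • ψ i := by
    rw [orthonormal_iff_ite]
    intro i j
    rw [real_inner_smul_left, real_inner_smul_right, horth]
    split_ifs
    · rw [← mul_assoc, ← mul_inv, Real.mul_self_sqrt (by linarith)]
      field_simp
    · simp
  -- Bessel with the roles exchanged: the normalised `ψ i` are the orthonormal system and `b j` is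
  -- the vector expanded.
  have hbessel : ∀ j, ∑ i, (inner ℝ (ψ i) (b j : H)) ^ 2 ≤ 2 * h := fun j => by
    have h1 := hon.sum_inner_products_le (s := Finset.univ) (b j : H)
    have h2 : ‖(b j : H)‖ = 1 := by
      exact b.orthonormal.1 j
    simp_rw [real_inner_smul_left, h2, Real.norm_eq_abs, sq_abs, mul_pow, inv_pow,
      Real.sq_sqrt (by linarith : 0 ≤ 2 * h)] at h1
    rw [← Finset.mul_sum, one_pow, inv_mul_le_iff₀ (by linarith), mul_one] at h1
    exact h1
  have hsum : ∑ i, ∑ j, (inner ℝ (ψ i) (b j : H)) ^ 2 ≤ n * (2 * h) := by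
    rw [Finset.sum_comm]
    refine (Finset.sum_le_sum fun j _ => hbessel j).trans ?_
    simp [hV]
  have hlt : ∑ i, ‖ψ i - v i‖ ^ 2 < ∑ _i : Fin (2 * n), h :=
    Finset.sum_lt_sum_of_nonempty ⟨⟨0, by omega⟩, Finset.mem_univ _⟩ fun i _ => hv i
  -- The squared distances sum to at least `2n · 2h - n · 2h = 2n · h`, against the strict upper
  -- bound in `hlt`.
  have hge := Finset.sum_le_sum fun i (_ : i ∈ Finset.univ) => hdist i
  rw [Finset.sum_sub_distrib] at hge
  simp only [Finset.sum_const, Finset.card_univ, Fintype.card_fin, nsmul_eq_mul, Nat.cast_mul,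
    Nat.cast_ofNat] at hge hlt
  nlinarith

namespace AdvectionDiffusion

lemma memLp_window (p : ℝ≥0∞) : MemLp window p :=
  memLp_indicator_const p measurableSet_Ioo 1 (Or.inr (by simp))

lemma measurable_window : Measurable window :=
  measurable_const.indicator measurableSet_Ioo

lemma memLp_window_comp_sub (t : ℝ) : MemLp (fun x => window (x - t)) 2 :=
  (memLp_window 2).comp_measurePreserving (measurePreserving_sub_right volume t)

lemma window_sub_mul_window_sub (s t x : ℝ) : window (x - s) * window (x - t) =
    (Ioo (max s t + 0.35) (min s t + 0.65)).indicator (fun _ => 1) x := by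
  have : x ∈ Ioo (max s t + 0.35) (min s t + 0.65) ↔
      x - s ∈ Ioo (0.35 : ℝ) 0.65 ∧ x - t ∈ Ioo (0.35 : ℝ) 0.65 := by
    simp only [mem_Ioo, ← lt_sub_iff_add_lt, ← sub_lt_iff_lt_add, max_lt_iff, lt_min_iff]
    constructor
    · rintro ⟨⟨_, _⟩, _, _⟩
      refine ⟨⟨?_, ?_⟩, ?_, ?_⟩ <;> linarith
    · rintro ⟨⟨_, _⟩, _, _⟩
      refine ⟨⟨?_, ?_⟩, ?_, ?_⟩ <;> linarith
  unfold window
  by_cases hs : x - s ∈ Ioo (0.35 : ℝ) 0.65 <;> by_cases ht : x - t ∈ Ioo (0.35 : ℝ) 0.65 <;>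
    simp [indicator, this, hs, ht]

lemma integral_window_sub_mul_window_sub (s t : ℝ) :
    ∫ x, window (x - s) * window (x - t) = max 0 (0.3 - |s - t|) := by
  simp_rw [window_sub_mul_window_sub]
  rw [integral_indicator measurableSet_Ioo]
  simp only [integral_const, MeasurableSet.univ, measureReal_restrict_apply, univ_inter,
    smul_eq_mul, mul_one, Real.volume_real_Ioo]
  rw [max_comm, ← max_sub_min_eq_abs']
  congr 1
  norm_num
  ring

/-- The transported window `φ(· - t)` as an element of `L²(ℝ)`. -/
noncomputable def windowLp (t : ℝ) : Lp ℝ 2 (volume : Measure ℝ) :=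
  (memLp_window_comp_sub t).toLp

lemma inner_windowLp (s t : ℝ) :
    inner ℝ (windowLp s) (windowLp t) = max 0 (0.3 - |s - t|) := by
  rw [L2.inner_def, ← integral_window_sub_mul_window_sub]
  refine integral_congr_ae ?_
  filter_upwards [(memLp_window_comp_sub s).coeFn_toLp, (memLp_window_comp_sub t).coeFn_toLp]
    with x h1 h2
  simp only [windowLp, h1, h2]
  simp [mul_comm]

/-- Each difference is `±1` on two strips of width `h`, one at either edge of the window; while the
total shift is at most the window length 0.3, strips of different indices do not overlap.
Algebraically, the maximum in the Gram matrix is inactive and what remains is a mixed second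
difference of `|k - l|`, which vanishes off the diagonal. -/
lemma inner_windowLp_sub_windowLp {h : ℝ} (h0 : 0 < h) {m : ℕ} (hm : m * h ≤ 0.3) (i j : Fin m) :
    inner ℝ (windowLp ((i + 1 : ℕ) * h) - windowLp ((i : ℕ) * h))
      (windowLp ((j + 1 : ℕ) * h) - windowLp ((j : ℕ) * h)) = if i = j then 2 * h else 0 := by
  have key : ∀ k l : ℕ, k ≤ m → l ≤ m →
      inner ℝ (windowLp (k * h)) (windowLp (l * h)) = 0.3 - |(k : ℤ) - (l : ℤ)| * h := by
    intro k l hk hl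
    have hk' : (k : ℝ) ≤ m := by exact_mod_cast hk
    have hl' : (l : ℝ) ≤ m := by exact_mod_cast hl
    have hle : |(k : ℝ) - l| ≤ m := by
      rw [abs_le]
      constructor <;> linarith [(Nat.cast_nonneg k : (0 : ℝ) ≤ k), (Nat.cast_nonneg l : (0 : ℝ) ≤ l)]
    rw [inner_windowLp, ← sub_mul, abs_mul, abs_of_pos h0, max_eq_right]
    · push_cast
      rfl
    · nlinarith
  have hi := i.2
  have hj := j.2
  rw [inner_sub_left, inner_sub_right, inner_sub_right, key _ _ (by omega) (by omega),
    key _ _ (by omega) (by omega), key _ _ (by omega) (by omega), key _ _ (by omega) (by omega)]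
  have hz : |((i + 1 : ℕ) : ℤ) - ((j : ℕ) : ℤ)| + |((i : ℕ) : ℤ) - ((j + 1 : ℕ) : ℤ)| -
      |((i + 1 : ℕ) : ℤ) - ((j + 1 : ℕ) : ℤ)| - |((i : ℕ) : ℤ) - ((j : ℕ) : ℤ)| =
      if i = j then 2 else 0 := by
    split_ifs with hij
    · subst hij
      simp
    · have : (i : ℕ) ≠ j := fun h => hij (Fin.ext h)
      rcases lt_or_gt_of_ne this with h | h
      · rw [abs_of_nonpos, abs_of_nonpos, abs_of_nonpos, abs_of_nonpos] <;> push_cast <;> omega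
      · rw [abs_of_nonneg, abs_of_nonneg, abs_of_nonneg, abs_of_nonneg] <;> push_cast <;> omega
  have hz' := congrArg (fun z : ℤ => (z : ℝ) * h) hz
  simp only [Int.cast_sub, Int.cast_add, Int.cast_ite, Int.cast_zero, Int.cast_ofNat] at hz'
  have : (if i = j then 2 * h else 0) = (if i = j then (2 : ℝ) else 0) * h := by
    split_ifs <;> simp
  rw [this, ← hz']
  push_cast
  ring

end AdvectionDiffusion
-- The `L²` distance between the smoothed and the sharp window.
namespace AdvectionDiffusion

lemma window_nonneg (x : ℝ) : 0 ≤ window x := indicator_nonneg (fun _ _ => zero_le_one) x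

lemma window_le_one (x : ℝ) : window x ≤ 1 := by
  unfold window
  by_cases h : x ∈ Ioo (0.35 : ℝ) 0.65 <;> simp [h]

lemma heatKernel_nonneg (μ x s : ℝ) : 0 ≤ heatKernel μ x s := by
  unfold heatKernel
  positivity

lemma continuous_heatKernel (μ s : ℝ) : Continuous fun x => heatKernel μ x s := by
  unfold heatKernel
  fun_prop

lemma integral_heatKernel {μ s : ℝ} (h : 0 < μ * s) : ∫ x, heatKernel μ x s = 1 := by
  have h1 : ∀ x, heatKernel μ x s = 1 / Real.sqrt (4 * Real.pi * μ * s) *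
      Real.exp (-(1 / (4 * (μ * s))) * x ^ 2) := fun x => by
    unfold heatKernel
    rw [← mul_assoc]
    congr 2
    ring
  simp_rw [h1]
  rw [integral_const_mul, integral_gaussian, div_div_eq_mul_div, div_one,
    show Real.pi * (4 * (μ * s)) = 4 * Real.pi * μ * s by ring, one_div_mul_cancel]
  exact (Real.sqrt_pos.2 (by nlinarith [Real.pi_pos])).ne'

lemma smoothedWindow_eq_integral_comp_sub (μ s x : ℝ) :
    smoothedWindow μ s x = ∫ y, heatKernel μ y s * window (x - y) := by
  rw [← integral_sub_left_eq_self _ volume x]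
  simp [smoothedWindow]

lemma integrable_heatKernel_mul_window (μ s x : ℝ) :
    Integrable fun y => heatKernel μ y s * window (x - y) := by
  refine (integrable_heatKernel μ s).mono'
    ((continuous_heatKernel μ s).aestronglyMeasurable.mul
      (measurable_window.comp (measurable_const.sub measurable_id)).aestronglyMeasurable)
    (Filter.Eventually.of_forall fun y => ?_)
  rw [norm_mul, Real.norm_of_nonneg (heatKernel_nonneg _ _ _),
    Real.norm_of_nonneg (window_nonneg _)]
  exact mul_le_of_le_one_right (heatKernel_nonneg _ _ _) (window_le_one _)

lemma smoothedWindow_sub_window {μ s : ℝ} (h : 0 < μ * s) (x : ℝ) :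
    smoothedWindow μ s x - window x =
      ∫ y, heatKernel μ y s * (window (x - y) - window x) := by
  simp_rw [mul_sub]
  rw [integral_sub (integrable_heatKernel_mul_window μ s x)
    ((integrable_heatKernel μ s).mul_const _), integral_mul_const, integral_heatKernel h, one_mul,
    smoothedWindow_eq_integral_comp_sub]

lemma abs_smoothedWindow_sub_window_le {μ s : ℝ} (h : 0 < μ * s) (x : ℝ) :
    |smoothedWindow μ s x - window x| ≤ 1 := by
  have h0 : 0 ≤ smoothedWindow μ s x := by
    rw [smoothedWindow_eq_integral_comp_sub]
    exact integral_nonneg fun y => mul_nonneg (heatKernel_nonneg _ _ _) (window_nonneg _)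
  have h1 : smoothedWindow μ s x ≤ 1 := by
    rw [smoothedWindow_eq_integral_comp_sub, ← integral_heatKernel h]
    exact integral_mono (integrable_heatKernel_mul_window μ s x) (integrable_heatKernel μ s)
      fun y => mul_le_of_le_one_right (heatKernel_nonneg _ _ _) (window_le_one _)
  rw [abs_le]
  constructor <;> linarith [window_nonneg x, window_le_one x]

lemma lintegral_enorm_window_sub_le (y : ℝ) :
    ∫⁻ x, ‖window (x - y) - window x‖ₑ ≤ ENNReal.ofReal (2 * |y|) := by
  have hi : Integrable fun x => window (x - y) - window x :=
    (integrable_window.comp_sub_right y).sub integrable_window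
  have hp : ∀ s t, Integrable fun x => window (x - s) * window (x - t) := fun s t =>
    (memLp_window_comp_sub s).integrable_mul (memLp_window_comp_sub t)
  -- For values in `{0, 1}`, `|a - b| = (a - b)²`, so the `L¹` distance reduces to overlap
  -- integrals.
  have habs : ∀ x, ‖window (x - y) - window x‖ = window (x - y) * window (x - y) -
      2 * (window (x - y) * window (x - 0)) + window (x - 0) * window (x - 0) := fun x => by
    rw [sub_zero]
    have : ∀ z, window z = 0 ∨ window z = 1 := fun z => by
      unfold window
      by_cases h : z ∈ Ioo (0.35 : ℝ) 0.65 <;> simp [h]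
    rcases this (x - y) with h1 | h1 <;> rcases this x with h2 | h2 <;> simp [h1, h2]
    norm_num
  rw [← ofReal_integral_norm_eq_lintegral_enorm hi]
  refine ENNReal.ofReal_le_ofReal ?_
  simp_rw [habs]
  rw [integral_add (f := fun x => window (x - y) * window (x - y) -
      2 * (window (x - y) * window (x - 0))) ((hp _ _).sub ((hp _ _).const_mul 2)) (hp _ _),
    integral_sub (hp _ _) ((hp _ _).const_mul 2), integral_const_mul,
    integral_window_sub_mul_window_sub, integral_window_sub_mul_window_sub,
    integral_window_sub_mul_window_sub]
  simp only [sub_self, abs_zero, sub_zero]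
  norm_num
  linarith [le_max_right (0 : ℝ) (3 / 10 - |y|)]

/-- Half of the Gaussian exponent absorbs the factor `|y|` via `z exp(-z²/2) ≤ 1` at `z = |y| /
(2√(μs))`; the other half is the kernel at time `2s`, whose integral is 1. This replaces the exact
first absolute moment. -/
lemma heatKernel_mul_abs_le {μ s : ℝ} (h : 0 < μ * s) (y : ℝ) :
    heatKernel μ y s * (2 * |y|) ≤ 4 * Real.sqrt 2 * Real.sqrt (μ * s) *
      heatKernel μ y (2 * s) := by
  have hr : 0 < Real.sqrt (μ * s) := Real.sqrt_pos.2 h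
  set r := Real.sqrt (μ * s) with hrdef
  have hr2 : r ^ 2 = μ * s := Real.sq_sqrt h.le
  have hμs : μ ≠ 0 ∧ s ≠ 0 := mul_ne_zero_iff.1 h.ne'
  have hexp : |y| / (2 * r) * Real.exp (-y ^ 2 / (8 * r ^ 2)) ≤ 1 := by
    have h1 := Real.add_one_le_exp (y ^ 2 / (8 * r ^ 2))
    have h2 : |y| / (2 * r) ≤ Real.exp (y ^ 2 / (8 * r ^ 2)) := by
      refine le_trans ?_ h1
      have h3 : y ^ 2 / (8 * r ^ 2) = (|y| / (2 * r)) ^ 2 / 2 := by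
        rw [div_pow, sq_abs]
        field_simp
        norm_num
      rw [h3]
      nlinarith [sq_nonneg (|y| / (2 * r) - 1)]
    rw [neg_div, Real.exp_neg]
    exact (mul_inv_le_iff₀ (Real.exp_pos _)).2 (by linarith)
  have hsq : Real.sqrt (4 * Real.pi * μ * (2 * s)) =
      Real.sqrt 2 * Real.sqrt (4 * Real.pi * μ * s) := by
    rw [← Real.sqrt_mul (by norm_num)]
    congr 1
    ring
  have hsplit : Real.exp (-y ^ 2 / (4 * μ * s)) =
      Real.exp (-y ^ 2 / (8 * r ^ 2)) * Real.exp (-y ^ 2 / (4 * μ * (2 * s))) := by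
    rw [← Real.exp_add, hr2]
    congr 1
    obtain ⟨_, _⟩ := hμs
    field_simp
    ring
  have hs2 : Real.sqrt 2 ≠ 0 := by positivity
  unfold heatKernel
  rw [hsq, hsplit]
  have hS : 0 < Real.sqrt (4 * Real.pi * μ * s) :=
    Real.sqrt_pos.2 (by nlinarith [Real.pi_pos])
  have e1 : 1 / Real.sqrt (4 * Real.pi * μ * s) * (Real.exp (-y ^ 2 / (8 * r ^ 2)) *
      Real.exp (-y ^ 2 / (4 * μ * (2 * s)))) * (2 * |y|) =
      (|y| / (2 * r) * Real.exp (-y ^ 2 / (8 * r ^ 2))) * (4 * r *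
      (1 / Real.sqrt (4 * Real.pi * μ * s) * Real.exp (-y ^ 2 / (4 * μ * (2 * s))))) := by
    field_simp
    ring
  have e2 : 4 * Real.sqrt 2 * r * (1 / (Real.sqrt 2 * Real.sqrt (4 * Real.pi * μ * s)) *
      Real.exp (-y ^ 2 / (4 * μ * (2 * s)))) = 4 * r *
      (1 / Real.sqrt (4 * Real.pi * μ * s) * Real.exp (-y ^ 2 / (4 * μ * (2 * s)))) := by
    field_simp
  rw [e1, e2]
  exact mul_le_of_le_one_left (by positivity) hexp

/-- The difference is at most 1 in absolute value, so its square is at most its absolute value. By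
Tonelli the `L¹` norm is at most the kernel average of the `L¹` translation error `2|y|`, of order
`√(μs)`. -/
theorem eLpNorm_smoothedWindow_sub_window_le {μ s : ℝ} (h : 0 < μ * s) :
    eLpNorm (fun x => smoothedWindow μ s x - window x) 2 volume ≤
      ENNReal.ofReal (Real.sqrt 6 * (μ * s) ^ (1 / 4 : ℝ)) := by
  have hI : ∫⁻ x, ‖smoothedWindow μ s x - window x‖ₑ ^ (2 : ℝ) ≤
      ENNReal.ofReal (6 * Real.sqrt (μ * s)) := by
    calc ∫⁻ x, ‖smoothedWindow μ s x - window x‖ₑ ^ (2 : ℝ)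
        ≤ ∫⁻ x, ∫⁻ y, ‖heatKernel μ y s‖ₑ * ‖window (x - y) - window x‖ₑ := by
          refine lintegral_mono fun x => ?_
          have h1 : ‖smoothedWindow μ s x - window x‖ₑ ≤ 1 := by
            rw [← ofReal_norm, ENNReal.ofReal_le_one]
            exact abs_smoothedWindow_sub_window_le h x
          refine (ENNReal.rpow_le_rpow_of_exponent_ge h1 (by norm_num : (1 : ℝ) ≤ 2)).trans ?_
          rw [ENNReal.rpow_one, smoothedWindow_sub_window h]
          refine (enorm_integral_le_lintegral_enorm _).trans ?_
          simp_rw [enorm_mul]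
          exact le_rfl
      _ = ∫⁻ y, ‖heatKernel μ y s‖ₑ * ∫⁻ x, ‖window (x - y) - window x‖ₑ := by
          rw [lintegral_lintegral_swap]
          · refine lintegral_congr fun y => ?_
            rw [lintegral_const_mul]
            exact ((measurable_window.comp (measurable_id.sub_const y)).sub
              measurable_window).enorm
          · refine Measurable.aemeasurable ?_
            refine ((continuous_heatKernel μ s).measurable.comp measurable_snd).enorm.mul ?_
            exact ((measurable_window.comp (measurable_fst.sub measurable_snd)).sub
              (measurable_window.comp measurable_fst)).enorm
      _ ≤ ∫⁻ y, ENNReal.ofReal (4 * Real.sqrt 2 * Real.sqrt (μ * s) *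
            heatKernel μ y (2 * s)) := by
          refine lintegral_mono fun y => ?_
          refine (mul_le_mul_right (lintegral_enorm_window_sub_le y) _).trans ?_
          rw [Real.enorm_of_nonneg (heatKernel_nonneg _ _ _),
            ← ENNReal.ofReal_mul (heatKernel_nonneg _ _ _)]
          exact ENNReal.ofReal_le_ofReal (heatKernel_mul_abs_le h y)
      _ = ENNReal.ofReal (4 * Real.sqrt 2 * Real.sqrt (μ * s)) := by
          rw [← ofReal_integral_eq_lintegral_ofReal ((integrable_heatKernel μ _).const_mul _)
            (Filter.Eventually.of_forall fun y => mul_nonneg (by positivity)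
              (heatKernel_nonneg _ _ _)), integral_const_mul, integral_heatKernel (by nlinarith),
            mul_one]
      _ ≤ ENNReal.ofReal (6 * Real.sqrt (μ * s)) := by
          refine ENNReal.ofReal_le_ofReal (mul_le_mul_of_nonneg_right ?_ (Real.sqrt_nonneg _))
          nlinarith [Real.sq_sqrt (by norm_num : (0 : ℝ) ≤ 2), Real.sqrt_nonneg 2]
  rw [eLpNorm_eq_lintegral_rpow_enorm_toReal (by norm_num) (by norm_num)]
  simp only [ENNReal.toReal_ofNat]
  refine (ENNReal.rpow_le_rpow hI (by norm_num)).trans (le_of_eq ?_)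
  rw [ENNReal.ofReal_rpow_of_nonneg (by positivity) (by norm_num),
    Real.mul_rpow (by norm_num) (Real.sqrt_nonneg _), ← Real.sqrt_eq_rpow, Real.sqrt_eq_rpow (μ * s),
    ← Real.rpow_mul h.le]
  norm_num

lemma norm_sol_toLp_sub_windowLp_le {μ σ₀ t : ℝ} (h : 0 < μ * (t + σ₀)) :
    ‖(memLp_sol μ σ₀ t).toLp - windowLp t‖ ≤
      Real.sqrt 6 * (μ * (t + σ₀)) ^ (1 / 4 : ℝ) := by
  unfold windowLp
  rw [← MemLp.toLp_sub, Lp.norm_toLp]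
  refine ENNReal.toReal_le_of_le_ofReal (by positivity) ?_
  refine le_trans (le_of_eq ?_) (eLpNorm_smoothedWindow_sub_window_le h)
  refine eLpNorm_comp_measurePreserving (g := fun x => smoothedWindow μ (t + σ₀) x - window x)
    ?_ (measurePreserving_sub_right volume t)
  exact (memLp_smoothedWindow μ _).1.sub measurable_window.aestronglyMeasurable

/-! ### The Eulerian lower bound. -/

/-- The argument naturally gives the constant `√6` before the smoothing term. Since a width is
nonnegative, the bound may be multiplied by `c / √6 ≤ 1`, which yields any smaller `c` at the price
of a smaller leading coefficient. -/
theorem le_eulerianWidth {T μ σ₀ : ℝ} (hT : 0 < T) (hμ : 0 < μ) (hσ₀ : 0 < σ₀) {n : ℕ}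
    (hn : 1 ≤ n) {c : ℝ} (hc : 0 < c) (hc6 : c ≤ Real.sqrt 6) :
    ENNReal.ofReal (Real.sqrt (min T 0.3 / 8) * c / Real.sqrt 6 * (n : ℝ) ^ (-(1 / 2) : ℝ) -
      c * (μ * (T + σ₀)) ^ (1 / 4 : ℝ)) ≤ eulerianWidth μ σ₀ T n := by
  unfold eulerianWidth kolmogorovWidth
  refine le_iInf₂ fun V hV => ?_
  obtain ⟨hVf, hVn⟩ := hV
  by_contra! hlt
  have hn0 : (0 : ℝ) < n := by exact_mod_cast hn
  have hmin : 0 < min T 0.3 := lt_min hT (by norm_num)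
  set R := Real.sqrt (min T 0.3 / 8) * c / Real.sqrt 6 * (n : ℝ) ^ (-(1 / 2) : ℝ) -
      c * (μ * (T + σ₀)) ^ (1 / 4 : ℝ) with hR
  have hRpos : 0 < R := by
    by_contra! hR0
    rw [ENNReal.ofReal_of_nonpos hR0] at hlt
    exact not_lt_zero hlt
  set E := (μ * (T + σ₀)) ^ (1 / 4 : ℝ) with hE
  have hclose : ∀ t ∈ Icc 0 T, ∃ v ∈ V, ‖windowLp t - v‖ < R + Real.sqrt 6 * E := by
    intro t ht
    have h1 := (le_iSup₂ (f := fun u (_ : u ∈ eulerianManifold μ σ₀ T) =>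
      ⨅ v ∈ V, ‖u - v‖ₑ) _ (mem_image_of_mem _ ht)).trans_lt hlt
    simp only [iInf_lt_iff] at h1
    obtain ⟨v, hv, hlt'⟩ := h1
    refine ⟨v, hv, ?_⟩
    rw [← ofReal_norm, ENNReal.ofReal_lt_ofReal_iff hRpos] at hlt'
    have ht0 : 0 < t + σ₀ := by linarith [ht.1]
    have h2 := norm_sol_toLp_sub_windowLp_le (mul_pos hμ ht0)
    have h3 : (μ * (t + σ₀)) ^ (1 / 4 : ℝ) ≤ E :=
      Real.rpow_le_rpow (by positivity) (by nlinarith [ht.2]) (by norm_num)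
    have h4 := norm_sub_le_norm_sub_add_norm_sub (windowLp t) ((memLp_sol μ σ₀ t).toLp) v
    rw [norm_sub_rev] at h2
    nlinarith [Real.sqrt_nonneg 6]
  -- With this step all `2n` shifts stay in `[0, T]`, and their total stays below the window length.
  set h := min T 0.3 / (2 * n : ℕ) with hh
  have h0 : 0 < h := by
    rw [hh]
    positivity
  have hmul : ((2 * n : ℕ) : ℝ) * h = min T 0.3 := by
    rw [hh]
    field_simp
  obtain ⟨i, hi⟩ := V.exists_le_norm_sub_sq_of_orthogonal hVn hn _ h0
    (inner_windowLp_sub_windowLp (m := 2 * n) h0 (hmul.trans_le (min_le_right _ _)))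
  have hmem : ∀ k : ℕ, k ≤ 2 * n → (k : ℝ) * h ∈ Icc 0 T := fun k hk => by
    refine ⟨by positivity, ?_⟩
    have hk' : (k : ℝ) ≤ (2 * n : ℕ) := by exact_mod_cast hk
    exact (mul_le_mul_of_nonneg_right hk' h0.le).trans (hmul.trans_le (min_le_left _ _))
  obtain ⟨v, hv, hv'⟩ := hclose _ (hmem (i + 1) (by omega))
  obtain ⟨w, hw, hw'⟩ := hclose _ (hmem i (by omega))
  have h1 := hi _ (V.sub_mem hv hw)
  rw [sub_sub_sub_comm] at h1
  have h2 := norm_sub_le (windowLp ((i + 1 : ℕ) * h) - v) (windowLp ((i : ℕ) * h) - w)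
  have h3 : R + Real.sqrt 6 * E ≤ Real.sqrt (min T 0.3 / 8) * (n : ℝ) ^ (-(1 / 2) : ℝ) := by
    have h6 : 0 < Real.sqrt 6 := by positivity
    set X := Real.sqrt (min T 0.3 / 8) * (n : ℝ) ^ (-(1 / 2) : ℝ) with hX
    have hR' : R = c / Real.sqrt 6 * X - c * E := by
      rw [hR, hX]
      ring
    have h7 : Real.sqrt 6 * E ≤ X := by
      have : 0 < c / Real.sqrt 6 * (X - Real.sqrt 6 * E) := by
        have : c / Real.sqrt 6 * (X - Real.sqrt 6 * E) = R := by
          rw [hR']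
          field_simp
        rwa [this]
      have := pos_of_mul_pos_right this (by positivity)
      linarith
    have h8 : c / Real.sqrt 6 ≤ 1 := (div_le_one h6).2 hc6
    have h9 : c * E = c / Real.sqrt 6 * (Real.sqrt 6 * E) := by field_simp
    rw [hR', h9]
    nlinarith
  -- A difference of two translates is approximated with twice the error of one, whence the 4;
  -- together with `h = min T 0.3 / (2n)` it makes the 8.
  have h4 : (Real.sqrt (min T 0.3 / 8) * (n : ℝ) ^ (-(1 / 2) : ℝ)) ^ 2 = h / 4 := by
    rw [mul_pow, Real.sq_sqrt (by positivity), ← Real.rpow_natCast, ← Real.rpow_mul hn0.le, hh]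
    norm_num
    rw [Real.rpow_neg_one]
    field_simp
    norm_num
  have hX0 : 0 ≤ Real.sqrt (min T 0.3 / 8) * (n : ℝ) ^ (-(1 / 2) : ℝ) := by positivity
  nlinarith [norm_nonneg (windowLp ((i + 1 : ℕ) * h) - v - (windowLp ((i : ℕ) * h) - w))]

end AdvectionDiffusion

/-! ### Plancherel for the Fourier integral, and the exponential series with remainder. -/

/-- **Plancherel's theorem** for the Fourier integral on `L¹ ∩ L²`. -/
theorem Real.eLpNorm_two_fourier_eq {f : ℝ → ℂ} (hf1 : Integrable f) (hf2 : MemLp f 2) :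
    eLpNorm (𝓕 f) 2 volume = eLpNorm f 2 volume := by
  set F : Lp ℂ 2 (volume : Measure ℝ) := 𝓕 (hf2.toLp f) with hF
  have hcont : Continuous (𝓕 f) :=
    VectorFourier.fourierIntegral_continuous Real.continuous_fourierChar
      (L := innerₗ ℝ) continuous_inner hf1
  -- The abstract `L²` transform agrees with the integral: both pair equally with smooth compactly
  -- supported functions, by duality for tempered distributions and for integrable functions.
  have hae : ∀ᵐ x, F x = 𝓕 f x := by
    refine ae_eq_of_integral_contDiff_smul_eq ((Lp.memLp F).locallyIntegrable (by norm_num))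
      hcont.locallyIntegrable fun g hg hgs => ?_
    have hg₁ : HasCompactSupport (Complex.ofRealCLM ∘ g) := hgs.comp_left rfl
    have hg₂ : ContDiff ℝ (↑(⊤ : ℕ∞)) (Complex.ofRealCLM ∘ g) := Complex.ofRealCLM.contDiff.comp hg
    set G := hg₁.toSchwartzMap hg₂ with hG
    have hGx : ∀ x, G x = (g x : ℂ) := fun x => rfl
    have h1 : Lp.toTemperedDistribution F G = Lp.toTemperedDistribution (hf2.toLp f) (𝓕 G) := by
      rw [hF, ← Lp.fourier_toTemperedDistribution_eq]
      rfl
    rw [Lp.toTemperedDistribution_apply, Lp.toTemperedDistribution_apply] at h1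
    have h2 : ∫ x, (𝓕 G) x • (hf2.toLp f) x = ∫ x, (𝓕 (G : ℝ → ℂ)) x • f x := by
      refine integral_congr_ae ?_
      filter_upwards [hf2.coeFn_toLp] with x hx
      rw [hx, SchwartzMap.fourier_coe]
    have h3 : ∫ x, (𝓕 (G : ℝ → ℂ)) x • f x = ∫ x, G x • 𝓕 f x := by
      simpa using! VectorFourier.integral_fourierIntegral_smul_eq_flip (L := innerₗ ℝ)
        Real.continuous_fourierChar continuous_inner G.integrable hf1
    rw [h2, h3] at h1
    simpa [hGx] using h1
  rw [← eLpNorm_congr_ae hae, ← ENNReal.toReal_eq_toReal_iff' (Lp.memLp F).2.ne hf2.2.ne,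
    ← Lp.norm_def, hF, Lp.norm_fourier_eq, Lp.norm_toLp]

theorem Real.eLpNorm_two_fourierInv_eq {f : ℝ → ℂ} (hf1 : Integrable f) (hf2 : MemLp f 2) :
    eLpNorm (𝓕⁻ f) 2 volume = eLpNorm f 2 volume := by
  have hmp := Measure.measurePreserving_neg (volume : Measure ℝ)
  rw [Real.fourierInv_eq_fourier_comp_neg,
    Real.eLpNorm_two_fourier_eq hf1.comp_neg (hf2.comp_measurePreserving hmp)]
  exact eLpNorm_comp_measurePreserving hf2.1 hmp

theorem Real.continuous_fourierInv {f : ℝ → ℂ} (hf : Integrable f) : Continuous (𝓕⁻ f) := by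
  rw [Real.fourierInv_eq_fourier_comp_neg]
  exact VectorFourier.fourierIntegral_continuous Real.continuous_fourierChar
    (L := innerₗ ℝ) continuous_inner hf.comp_neg

theorem Real.fourierInv_sub_sum {ι : Type*} (s : Finset ι) {f : ℝ → ℂ} {g : ι → ℝ → ℂ}
    (a : ι → ℂ) (hf : Integrable f) (hg : ∀ i ∈ s, Integrable (g i)) (x : ℝ) :
    𝓕⁻ (fun ξ => f ξ - ∑ i ∈ s, a i * g i ξ) x = 𝓕⁻ f x - ∑ i ∈ s, a i * 𝓕⁻ (g i) x := by
  have hint : ∀ {u : ℝ → ℂ}, Integrable u →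
      Integrable fun ξ => Real.fourierChar (inner ℝ ξ x) • u ξ := fun {u} hu => by
    have := (Real.fourierIntegral_convergent_iff (μ := volume) (f := u) (-x)).2 hu
    simpa using this
  have hag : ∀ i ∈ s, Integrable fun ξ => a i * (Real.fourierChar (inner ℝ ξ x) • g i ξ) :=
    fun i hi => (hint (hg i hi)).const_mul _
  simp only [Real.fourierInv_eq]
  simp_rw [← integral_const_mul]
  rw [← integral_finsetSum _ hag, ← integral_sub (hint hf) (integrable_finsetSum _ hag)]
  refine integral_congr_ae (Filter.Eventually.of_forall fun ξ => ?_)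
  simp only [smul_sub, Finset.smul_sum, mul_smul_comm]

/-- Taylor expansion of `e ^ (-L s)` about `s₀`, uniformly in `L ≥ 0`. -/
theorem Real.abs_exp_neg_mul_sub_sum_le {L s₀ δ τ : ℝ} (hL : 0 ≤ L) (hδ : |δ| ≤ τ) (hτ : τ < s₀)
    (m : ℕ) :
    |Real.exp (-(L * (s₀ + δ))) -
        ∑ k ∈ Finset.range m, (-δ) ^ k / k.factorial * (L ^ k * Real.exp (-(L * s₀)))| ≤
      (τ / s₀) ^ m / (1 - τ / s₀) := by
  have hτ0 : 0 ≤ τ := (abs_nonneg δ).trans hδ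
  have hs₀ : 0 < s₀ := hτ0.trans_lt hτ
  have hq0 : 0 ≤ τ / s₀ := by positivity
  have hq1 : τ / s₀ < 1 := (div_lt_one hs₀).2 hτ
  have hsum : HasSum (fun k : ℕ => (-δ) ^ k / k.factorial * (L ^ k * Real.exp (-(L * s₀))))
      (Real.exp (-(L * (s₀ + δ)))) := by
    have h := (NormedSpace.expSeries_div_hasSum_exp (-δ * L)).mul_right (Real.exp (-(L * s₀)))
    rw [← Real.exp_eq_exp_ℝ, ← Real.exp_add] at h
    rw [show -(L * (s₀ + δ)) = -δ * L + -(L * s₀) by ring]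
    have hterm : (fun k : ℕ => (-δ) ^ k / k.factorial * (L ^ k * Real.exp (-(L * s₀)))) =
        fun k => (-δ * L) ^ k / k.factorial * Real.exp (-(L * s₀)) := by
      funext k
      rw [mul_pow]
      ring
    rw [hterm]
    exact h
  have htail := (hasSum_nat_add_iff' m).2 hsum
  have hgeom : HasSum (fun k : ℕ => (τ / s₀) ^ (k + m)) ((τ / s₀) ^ m / (1 - τ / s₀)) := by
    simp_rw [pow_add, div_eq_inv_mul ((τ / s₀) ^ m)]
    exact (hasSum_geometric_of_lt_one hq0 hq1).mul_right _
  refine htail.norm_le_of_bounded hgeom fun k => ?_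
  generalize k + m = j
  -- The factor `exp(-L s₀)` beats `(L s₀)^j / j!`, so the remaining bound `(τ/s₀)^j` no longer
  -- involves `L`.
  have h1 : (L * s₀) ^ j / j.factorial ≤ Real.exp (L * s₀) :=
    Real.pow_div_factorial_le_exp _ (by positivity) j
  have h2 : (L * s₀) ^ j / j.factorial * Real.exp (-(L * s₀)) ≤ 1 := by
    rw [Real.exp_neg]
    exact (mul_inv_le_iff₀ (Real.exp_pos _)).2 (by linarith)
  rw [norm_mul, norm_div, norm_pow, norm_neg, Real.norm_eq_abs, Real.norm_of_nonneg (by positivity),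
    Real.norm_of_nonneg (by positivity)]
  calc |δ| ^ j / j.factorial * (L ^ j * Real.exp (-(L * s₀)))
      ≤ τ ^ j / j.factorial * (L ^ j * Real.exp (-(L * s₀))) := by gcongr
    _ = (τ / s₀) ^ j * ((L * s₀) ^ j / j.factorial * Real.exp (-(L * s₀))) := by
      rw [div_pow, mul_pow]
      field_simp
    _ ≤ (τ / s₀) ^ j := mul_le_of_le_one_right (by positivity) h2

/-! ### The heat flow on the Fourier side. -/

namespace AdvectionDiffusion

lemma integrable_ofReal_window : Integrable fun y => (window y : ℂ) :=
  Complex.ofRealCLM.integrable_comp integrable_window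

lemma memLp_ofReal_window : MemLp (fun y => (window y : ℂ)) 2 :=
  Complex.ofRealCLM.comp_memLp' (memLp_window 2)

/-- The Fourier transform of the window. -/
noncomputable def windowFourier : ℝ → ℂ := 𝓕 fun y => (window y : ℂ)

lemma continuous_windowFourier : Continuous windowFourier :=
  VectorFourier.fourierIntegral_continuous Real.continuous_fourierChar
    (L := innerₗ ℝ) continuous_inner integrable_ofReal_window

lemma norm_windowFourier_le (ξ : ℝ) : ‖windowFourier ξ‖ ≤ ∫ y, ‖(window y : ℂ)‖ :=
  VectorFourier.norm_fourierIntegral_le_integral_norm _ _ _ _ _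

lemma eLpNorm_windowFourier : eLpNorm windowFourier 2 volume = eLpNorm window 2 volume := by
  unfold windowFourier
  rw [Real.eLpNorm_two_fourier_eq integrable_ofReal_window memLp_ofReal_window]
  exact eLpNorm_congr_norm_ae (Filter.Eventually.of_forall fun x => by simp)

lemma memLp_windowFourier : MemLp windowFourier 2 :=
  ⟨continuous_windowFourier.aestronglyMeasurable, by
    rw [eLpNorm_windowFourier]
    exact (memLp_window 2).2⟩

/-- The symbol of `-μ ∂ₓ²`. -/
noncomputable def heatSymbol (μ ξ : ℝ) : ℝ := 4 * Real.pi ^ 2 * μ * ξ ^ 2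

lemma heatSymbol_nonneg {μ : ℝ} (hμ : 0 < μ) (ξ : ℝ) : 0 ≤ heatSymbol μ ξ := by
  unfold heatSymbol
  positivity

/-- The Fourier transform of `(-μ ∂ₓ²) ^ k (G(·, s) ∗ φ)`. -/
noncomputable def heatMoment (μ s : ℝ) (k : ℕ) (ξ : ℝ) : ℂ :=
  ((heatSymbol μ ξ ^ k * Real.exp (-(heatSymbol μ ξ * s)) : ℝ) : ℂ) * windowFourier ξ

lemma integrable_exp_neg_heatSymbol_mul {μ s : ℝ} (hμ : 0 < μ) (hs : 0 < s) :
    Integrable fun ξ => Real.exp (-(heatSymbol μ ξ * s)) := by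
  have hb : 0 < 4 * Real.pi ^ 2 * μ * s := by positivity
  refine (integrable_exp_neg_mul_sq hb).congr (Filter.Eventually.of_forall fun ξ => ?_)
  simp only [heatSymbol]
  congr 1
  ring

/-- Half of the exponential absorbs the power: `L^k ≤ k! / (s/2)^k · exp(L s/2)`. The other half is
an integrable Gaussian. -/
lemma integrable_heatMoment {μ s : ℝ} (hμ : 0 < μ) (hs : 0 < s) (k : ℕ) :
    Integrable (heatMoment μ s k) := by
  have hdom := ((integrable_exp_neg_heatSymbol_mul hμ (half_pos hs)).const_mul
    (k.factorial / (s / 2) ^ k)).mul_const (∫ y, ‖(window y : ℂ)‖)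
  refine hdom.mono' ?_ (Filter.Eventually.of_forall fun ξ => ?_)
  · refine Continuous.aestronglyMeasurable ?_
    unfold heatMoment heatSymbol
    exact (Complex.continuous_ofReal.comp (by fun_prop)).mul continuous_windowFourier
  · have h0 := heatSymbol_nonneg hμ ξ
    unfold heatMoment
    rw [norm_mul, Complex.norm_real, Real.norm_of_nonneg (by positivity)]
    refine mul_le_mul ?_ (norm_windowFourier_le ξ) (norm_nonneg _) (by positivity)
    have h1 := Real.pow_div_factorial_le_exp (heatSymbol μ ξ * (s / 2)) (by positivity) k
    have h2 : Real.exp (-(heatSymbol μ ξ * s)) = Real.exp (-(heatSymbol μ ξ * (s / 2))) *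
        (Real.exp (heatSymbol μ ξ * (s / 2)))⁻¹ := by
      rw [← Real.exp_neg, ← Real.exp_add]
      congr 1
      ring
    rw [div_le_iff₀ (by positivity), mul_pow] at h1
    rw [h2, ← mul_assoc, mul_inv_le_iff₀ (Real.exp_pos _), mul_assoc _ _ (Real.exp (_ * _)),
      ← Real.exp_add, neg_add_cancel, Real.exp_zero, mul_one,
      le_div_iff₀ (by positivity), Real.exp_neg, mul_right_comm, mul_inv_le_iff₀ (Real.exp_pos _)]
    linarith

lemma smoothedWindow_eq_fourierInv {μ s : ℝ} (hμ : 0 < μ) (hs : 0 < s) (x : ℝ) :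
    (smoothedWindow μ s x : ℂ) = 𝓕⁻ (heatMoment μ s 0) x := by
  have hb : 0 < ((4 * Real.pi * μ * s : ℝ) : ℂ).re := by
    rw [Complex.ofReal_re]
    positivity
  -- This is `exp(-L s)` times the character at `x`. Its Fourier transform is the heat kernel
  -- centred at `x`, so moving the transform onto the window gives the inversion integral without an
  -- inversion theorem.
  set g : ℝ → ℂ := fun ξ => Complex.exp (-Real.pi * ((4 * Real.pi * μ * s : ℝ) : ℂ) * ξ ^ 2 +
    2 * Real.pi * (Complex.I * x) * ξ) with hg
  have hgF : ∀ y, 𝓕 g y = (heatKernel μ (x - y) s : ℂ) := fun y => by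
    rw [hg, fourier_gaussian_pi' hb]
    unfold heatKernel
    have h1 : ((4 * Real.pi * μ * s : ℝ) : ℂ) ^ (1 / 2 : ℂ) =
        (Real.sqrt (4 * Real.pi * μ * s) : ℂ) := by
      rw [Real.sqrt_eq_rpow, Complex.ofReal_cpow (by positivity)]
      norm_num
    simp only [h1]
    push_cast
    congr 2
    have hI : (y + Complex.I * (Complex.I * x) : ℂ) = -(x - y) := by
      rw [← mul_assoc, Complex.I_mul_I]
      ring
    rw [hI]
    have : (Real.pi : ℂ) ≠ 0 := by exact_mod_cast Real.pi_ne_zero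
    have : (μ : ℂ) ≠ 0 := by exact_mod_cast hμ.ne'
    have : (s : ℂ) ≠ 0 := by exact_mod_cast hs.ne'
    field_simp
  have hgchar : ∀ ξ, g ξ = Real.fourierChar (inner ℝ ξ x) •
      ((Real.exp (-(heatSymbol μ ξ * s)) : ℝ) : ℂ) := fun ξ => by
    rw [Circle.smul_def, Real.fourierChar_apply, smul_eq_mul, Complex.ofReal_exp,
      ← Complex.exp_add, hg]
    simp only [heatSymbol, RCLike.inner_apply, conj_trivial]
    congr 1
    push_cast
    ring
  have hgint : Integrable g := by
    have := (Real.fourierIntegral_convergent_iff (μ := volume) (-x)).2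
      (Complex.ofRealCLM.integrable_comp (integrable_exp_neg_heatSymbol_mul hμ hs))
    refine this.congr (Filter.Eventually.of_forall fun ξ => ?_)
    simp [hgchar]
  have hswap : ∫ y, 𝓕 g y • ((window y : ℝ) : ℂ) = ∫ ξ, g ξ • windowFourier ξ := by
    simpa using! VectorFourier.integral_fourierIntegral_smul_eq_flip (L := innerₗ ℝ)
      Real.continuous_fourierChar continuous_inner hgint integrable_ofReal_window
  unfold smoothedWindow
  rw [← integral_complex_ofReal, Real.fourierInv_eq]
  simp_rw [hgF] at hswap
  simp only [Complex.ofReal_mul, smul_eq_mul] at hswap ⊢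
  refine hswap.trans (integral_congr_ae (Filter.Eventually.of_forall fun ξ => ?_))
  simp [hgchar, heatMoment, smul_mul_assoc]

end AdvectionDiffusion

/-! ### The Lagrangian upper bound. -/

/-- The width ranges over spaces of dimension exactly `n`, while a spanning family may be dependent;
in an infinite-dimensional space its span can be padded. -/
theorem Submodule.exists_le_finrank_eq {X : Type*} [AddCommGroup X] [Module ℝ X]
    (hX : ¬ FiniteDimensional ℝ X) (V : Submodule ℝ X) [FiniteDimensional ℝ V] {n : ℕ}
    (hV : Module.finrank ℝ V ≤ n) :
    ∃ W : Submodule ℝ X, V ≤ W ∧ FiniteDimensional ℝ W ∧ Module.finrank ℝ W = n := by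
  induction n, hV using Nat.le_induction with
  | base => exact ⟨V, le_rfl, inferInstance, rfl⟩
  | succ n _ ih =>
    obtain ⟨W, hVW, hWf, hWn⟩ := ih
    obtain ⟨x, hx⟩ : ∃ x, x ∉ W := by
      by_contra! h
      have : W = ⊤ := eq_top_iff.2 fun x _ => h x
      subst this
      exact hX (Module.Finite.equiv (Submodule.topEquiv (R := ℝ) (M := X)))
    refine ⟨W ⊔ Submodule.span ℝ {x}, hVW.trans le_sup_left, inferInstance, ?_⟩
    have h1 : Module.finrank ℝ (W ⊓ Submodule.span ℝ {x} : Submodule ℝ X) = 0 := by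
      rw [disjoint_iff.1 (Submodule.disjoint_span_singleton_of_notMem hx)]
      exact finrank_bot ℝ X
    have h2 := Submodule.finrank_sup_add_finrank_inf_eq W (Submodule.span ℝ {x})
    have hx0 : x ≠ 0 := fun h => hx (h ▸ W.zero_mem)
    rw [h1, finrank_span_singleton hx0, hWn] at h2
    omega

namespace AdvectionDiffusion

lemma kolmogorovWidth_le_of_span {X : Type*} [AddCommGroup X] [Module ℝ X]
    (hX : ¬ FiniteDimensional ℝ X) {N : X → ℝ≥0∞} {M : Set X} {n : ℕ} {ι : Type*} [Fintype ι]
    (b : ι → X) (hι : Fintype.card ι ≤ n) {B : ℝ≥0∞}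
    (h : ∀ u ∈ M, ∃ v ∈ Submodule.span ℝ (range b), N (u - v) ≤ B) :
    kolmogorovWidth N M n ≤ B := by
  have : FiniteDimensional ℝ (Submodule.span ℝ (range b)) :=
    FiniteDimensional.span_of_finite ℝ (finite_range b)
  obtain ⟨W, hW, hWf, hWn⟩ := Submodule.exists_le_finrank_eq hX (Submodule.span ℝ (range b))
    ((finrank_range_le_card b).trans hι)
  refine iInf₂_le_of_le W ⟨hWf, hWn⟩ (iSup₂_le fun u hu => ?_)
  obtain ⟨v, hv, hle⟩ := h u hu
  exact iInf₂_le_of_le v (hW hv) hle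

lemma not_finiteDimensional_aeeqFun :
    ¬ FiniteDimensional ℝ (ℝ →ₘ[volume] EuclideanSpace ℝ (Fin 2)) := by
  intro hfin
  let L : Polynomial ℝ →ₗ[ℝ] C(ℝ, EuclideanSpace ℝ (Fin 2)) :=
    { toFun := fun p => ⟨fun x => !₂[p.eval x, 0], by fun_prop⟩
      map_add' := fun p q => by
        ext x i
        fin_cases i <;> simp
      map_smul' := fun a p => by
        ext x i
        fin_cases i <;> simp }
  let J : Polynomial ℝ →ₗ[ℝ] (ℝ →ₘ[volume] EuclideanSpace ℝ (Fin 2)) :=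
    (ContinuousMap.toAEEqFunLinearMap volume).comp L
  have hJ : Function.Injective J := by
    rw [← LinearMap.ker_eq_bot, LinearMap.ker_eq_bot']
    intro p hp
    have h0 : (L p).toAEEqFun volume = (0 : C(ℝ, EuclideanSpace ℝ (Fin 2))).toAEEqFun volume := hp
    have h1 : (L p : ℝ → EuclideanSpace ℝ (Fin 2)) =ᵐ[volume] fun _ => 0 :=
      AEEqFun.mk_eq_mk.1 h0
    have h2 := (Continuous.ae_eq_iff_eq volume (L p).continuous continuous_const).1 h1
    refine Polynomial.funext fun x => ?_
    have := congrArg (fun v : EuclideanSpace ℝ (Fin 2) => v 0) (congrFun h2 x)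
    simpa [L] using this
  exact Polynomial.not_finite (R := ℝ) (Module.Finite.of_injective J hJ)

/-- The Taylor polynomial of degree `< m` of the heat flow about time `s₀` converges geometrically in
`L²(ℝ)`. -/
lemma eLpNorm_smoothedWindow_sub_taylor_le {μ s₀ δ τ : ℝ} (hμ : 0 < μ) (hδ : |δ| ≤ τ) (hτ : τ < s₀)
    (m : ℕ) :
    eLpNorm (fun x => smoothedWindow μ (s₀ + δ) x - ∑ k ∈ Finset.range m,
      (-δ) ^ k / k.factorial * (𝓕⁻ (heatMoment μ s₀ k) x).re) 2 volume ≤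
      eLpNorm window 2 volume * ENNReal.ofReal ((τ / s₀) ^ m / (1 - τ / s₀)) := by
  have hs₀ : 0 < s₀ := ((abs_nonneg δ).trans hδ).trans_lt hτ
  have hs : 0 < s₀ + δ := by linarith [neg_abs_le δ]
  set a : ℕ → ℂ := fun k => (((-δ) ^ k / k.factorial : ℝ) : ℂ) with ha
  set r : ℝ → ℂ := fun ξ => heatMoment μ (s₀ + δ) 0 ξ - ∑ k ∈ Finset.range m,
    a k * heatMoment μ s₀ k ξ with hr
  have hr1 : Integrable r := (integrable_heatMoment hμ hs 0).sub
    (integrable_finsetSum _ fun k _ => (integrable_heatMoment hμ hs₀ k).const_mul _)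
  have hbound : ∀ ξ, ‖r ξ‖ ≤ (τ / s₀) ^ m / (1 - τ / s₀) * ‖windowFourier ξ‖ := fun ξ => by
    have h1 : r ξ = ((Real.exp (-(heatSymbol μ ξ * (s₀ + δ))) - ∑ k ∈ Finset.range m,
        (-δ) ^ k / k.factorial * (heatSymbol μ ξ ^ k * Real.exp (-(heatSymbol μ ξ * s₀))) : ℝ) : ℂ)
        * windowFourier ξ := by
      simp only [hr, ha, heatMoment]
      push_cast
      rw [sub_mul, Finset.sum_mul]
      simp only [pow_zero, one_mul, mul_assoc]
    rw [h1, norm_mul, Complex.norm_real]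
    exact mul_le_mul_of_nonneg_right
      (Real.abs_exp_neg_mul_sub_sum_le (heatSymbol_nonneg hμ ξ) hδ hτ m) (norm_nonneg _)
  have hr2 : MemLp r 2 :=
    memLp_windowFourier.of_le_mul hr1.aestronglyMeasurable (Filter.Eventually.of_forall hbound)
  calc _ ≤ eLpNorm (𝓕⁻ r) 2 volume := by
        -- The real error is the real part of the inverse transform of `r`, hence no larger in
        -- modulus.
        refine eLpNorm_mono fun x => ?_
        rw [hr, Real.fourierInv_sub_sum _ _ (integrable_heatMoment hμ hs 0)
          fun k _ => integrable_heatMoment hμ hs₀ k, ← smoothedWindow_eq_fourierInv hμ hs]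
        refine le_trans (le_of_eq ?_) (Complex.abs_re_le_norm _)
        simp [ha, Real.norm_eq_abs, -Complex.ofReal_div, -Complex.ofReal_pow, -Complex.ofReal_neg]
    _ = eLpNorm r 2 volume := Real.eLpNorm_two_fourierInv_eq hr1 hr2
    _ ≤ _ := by
        rw [← eLpNorm_windowFourier, mul_comm]
        exact eLpNorm_le_mul_eLpNorm_of_ae_le_mul (Filter.Eventually.of_forall hbound) 2

/-- The reduced basis of the Lagrangian frame: the identity and the constant in the first component,
the Taylor coefficients of the heat flow at time `s₀` in the second. -/
noncomputable def lagrangianBasis {μ s₀ : ℝ} (hμ : 0 < μ) (hs₀ : 0 < s₀) (m : ℕ) :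
    Option (Option (Fin m)) → C(ℝ, EuclideanSpace ℝ (Fin 2))
  | none => ⟨fun x => !₂[x, 0], by fun_prop⟩
  | some none => ⟨fun _ => !₂[1, 0], by fun_prop⟩
  | some (some k) => ⟨fun x => !₂[0, (𝓕⁻ (heatMoment μ s₀ k) x).re], by
      have := Real.continuous_fourierInv (integrable_heatMoment hμ hs₀ k)
      fun_prop⟩

theorem lagrangianWidth_le {T μ σ₀ : ℝ} (hT : 0 < T) (hμ : 0 < μ) (hσ₀ : 0 < σ₀) {n : ℕ}
    (hn : 2 < n) :
    lagrangianWidth μ σ₀ T n ≤ eLpNorm window 2 volume *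
      ENNReal.ofReal (((T / 2) / (T / 2 + σ₀)) ^ (n - 2) / (1 - (T / 2) / (T / 2 + σ₀))) := by
  obtain ⟨m, rfl⟩ : ∃ m, n = m + 2 := ⟨n - 2, by omega⟩
  rw [Nat.add_sub_cancel]
  have hs₀ : 0 < T / 2 + σ₀ := by positivity
  set B := lagrangianBasis hμ hs₀ m with hB
  let J : C(ℝ, EuclideanSpace ℝ (Fin 2)) →ₗ[ℝ] (ℝ →ₘ[volume] EuclideanSpace ℝ (Fin 2)) :=
    ContinuousMap.toAEEqFunLinearMap volume
  refine kolmogorovWidth_le_of_span not_finiteDimensional_aeeqFun (J ∘ B) (by simp) ?_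
  rintro _ ⟨t, ht, rfl⟩
  have hδ : |t - T / 2| ≤ T / 2 := by
    rw [abs_le]
    constructor <;> linarith [ht.1, ht.2]
  -- The Taylor increment is `t - T/2`, since `t + σ₀ = (T/2 + σ₀) + (t - T/2)`. The first component
  -- `x + t` is reproduced exactly, so the difference has only the heat-flow error, although neither
  -- term is itself in `L²`.
  set c : C(ℝ, EuclideanSpace ℝ (Fin 2)) := B none + t • B (some none) +
    ∑ k : Fin m, ((-(t - T / 2)) ^ (k : ℕ) / (k : ℕ).factorial) • B (some (some k)) with hc
  have hmem : ∀ i, B i ∈ Submodule.span ℝ (range B) := fun i => Submodule.subset_span ⟨i, rfl⟩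
  refine ⟨J c, ?_, ?_⟩
  · rw [range_comp, Submodule.span_image]
    exact Submodule.mem_map_of_mem (add_mem (add_mem (hmem _) (Submodule.smul_mem _ _ (hmem _)))
      (sum_mem fun k _ => Submodule.smul_mem _ _ (hmem _)))
  · refine le_trans ?_ (eLpNorm_smoothedWindow_sub_taylor_le hμ hδ (by linarith) m)
    have hmk : AEEqFun.mk (lagrangianState μ σ₀ t) (aestronglyMeasurable_lagrangianState μ σ₀ t) -
        J c = AEEqFun.mk (lagrangianState μ σ₀ t - ⇑c)
          ((aestronglyMeasurable_lagrangianState μ σ₀ t).sub c.continuous.aestronglyMeasurable) :=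
      (AEEqFun.mk_sub _ _ _ _).symm
    simp only
    rw [hmk, eLpNorm_congr_ae (AEEqFun.coeFn_mk _ _)]
    refine le_of_eq (eLpNorm_congr_norm_ae (Filter.Eventually.of_forall fun x => ?_))
    have hcx : c x = !₂[x + t, ∑ k ∈ Finset.range m, (-(t - T / 2)) ^ k / k.factorial *
        (𝓕⁻ (heatMoment μ (T / 2 + σ₀) k) x).re] := by
      rw [Finset.sum_range, hc]
      ext i
      fin_cases i <;> simp [hB, lagrangianBasis, ContinuousMap.sum_apply]
    rw [Pi.sub_apply, hcx, EuclideanSpace.norm_eq]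
    simp only [lagrangianState, sol, charLine, Fin.sum_univ_two]
    simp [Real.sqrt_sq_eq_abs, show T / 2 + σ₀ + (t - T / 2) = t + σ₀ by ring]

end AdvectionDiffusion

theorem theorem3 :
    -- `u` solves the initial value problem, and has the closed form through the normal CDF
    (∀ μ σ₀ : ℝ, 0 < μ → 0 < σ₀ →
      AdvectionDiffusion.IsSolution μ (AdvectionDiffusion.smoothedWindow μ σ₀)
        (AdvectionDiffusion.sol μ σ₀) ∧
      ∀ x t : ℝ, 0 ≤ t → AdvectionDiffusion.sol μ σ₀ x t =
        AdvectionDiffusion.gaussCDF ((x - t - 0.35) / Real.sqrt (2 * μ * (t + σ₀))) -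
        AdvectionDiffusion.gaussCDF ((x - t - 0.65) / Real.sqrt (2 * μ * (t + σ₀)))) ∧
    -- Eulerian frame
    (∀ T : ℝ, 0 < T → ∃ c₂ : ℝ, 0 < c₂ ∧ ∀ μ σ₀ : ℝ, 0 < μ → 0 < σ₀ → ∀ n : ℕ, 1 ≤ n →
      ENNReal.ofReal (c₂ * (n : ℝ) ^ (-(1 / 2) : ℝ) -
          Real.sqrt ((4 - 2 * Real.sqrt 2) / Real.sqrt Real.pi) *
            (μ * (T + σ₀)) ^ (1 / 4 : ℝ)) ≤
        AdvectionDiffusion.eulerianWidth μ σ₀ T n) ∧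
    -- Lagrangian frame
    (∀ T μ σ₀ : ℝ, 0 < T → 0 < μ → 0 < σ₀ → ∀ n : ℕ, 2 < n →
      AdvectionDiffusion.lagrangianWidth μ σ₀ T n ≤
        eLpNorm AdvectionDiffusion.window 2 MeasureTheory.volume *
          ENNReal.ofReal (((T / 2) / (T / 2 + σ₀)) ^ (n - 2) /
            (1 - (T / 2) / (T / 2 + σ₀)))) := by
  refine ⟨fun μ σ₀ hμ hσ₀ => ⟨AdvectionDiffusion.isSolution_sol hμ hσ₀, fun x t ht =>
    AdvectionDiffusion.sol_eq_gaussCDF hμ (by linarith) x⟩, fun T hT => ?_,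
    fun T μ σ₀ hT hμ hσ₀ n hn => AdvectionDiffusion.lagrangianWidth_le hT hμ hσ₀ hn⟩
  have h2 : Real.sqrt 2 < 2 := by
    rw [Real.sqrt_lt' (by norm_num)]
    norm_num
  have hc0 : 0 < 4 - 2 * Real.sqrt 2 := by linarith
  have hpi : 1 ≤ Real.sqrt Real.pi := by
    rw [Real.one_le_sqrt]
    linarith [Real.pi_gt_three]
  have hc : 0 < Real.sqrt ((4 - 2 * Real.sqrt 2) / Real.sqrt Real.pi) :=
    Real.sqrt_pos.2 (by positivity)
  have hc6 : Real.sqrt ((4 - 2 * Real.sqrt 2) / Real.sqrt Real.pi) ≤ Real.sqrt 6 := by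
    refine Real.sqrt_le_sqrt ((div_le_iff₀ (by linarith)).2 ?_)
    nlinarith [Real.sqrt_nonneg 2]
  have hmin : 0 < min T 0.3 := lt_min hT (by norm_num)
  -- The witness is `√(min T 0.3 / 8) · c / √6` with `c` the numerical square root above, hence a
  -- function of `T` alone.
  exact ⟨_, by positivity, fun μ σ₀ hμ hσ₀ n hn =>
    AdvectionDiffusion.le_eulerianWidth hT hμ hσ₀ hn hc hc6⟩
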